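/- Let $a \neq b$ be letters. For $k \ge 1$ let $$X_k=a^{k-1}b\,aa^{k-1}b\,a^{k-1}b\,aa^{k-1}b\,aa^{k-1}b\,a^{k-1}b,$$ a word of length $6k+3$, and for integers $1\le i<j$ let $Y_{i,j}=X_iX_{i+1}\cdots X_{j-1}X_j\,aa^{j-1}$. A square is a word $xx$ with $x$ nonempty (its root). For a word $w$ of length $n$, the distinct-square-sequence is $s(w)=s_1s_2\cdots s_n$, where $s_p$ is the number of distinct squares whose last (rightmost) occurrence in $w$ begins at position $p$. Let $i\le k<j$. Then the part of $s(Y_{i,j})$ at the $6k+3$ positions of the factor $X_k$ of $Y_{i,j}=(X_i\cdots X_{k-1})\,X_k\,(X_{k+1}\cdots X_j\,aa^{j-1})$ is $$1^{2k+1}\,0^{k+1}\,1^k\,0\,1^{2k}.$$ Hence exactly $5k+1$ distinct squares have their last occurrence in $Y_{i,j}$ beginning in $X_k$. They are exactly the following squares, and no other square has its last occurrence in $Y_{i,j}$ beginning in $X_k$. Here positions are counted from $1$ inside $X_k$; in each row exactly one square has its last occurrence beginning at each position of the row, its root at the first position of the row is the given word, and its roots at the following positions are the successive cyclic shifts of that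 word (first letter moved to the end). - positions $1,\dots,2k+1$: root $a^{k-1}ba\,a^{k-1}b\,a^{k-1}ba$ of length $3k+2$; - positions $2k+2,\dots,3k+2$: no square; - positions $3k+3,\dots,4k+2$: root $a^{k-1}ba\,a^{k-1}b$ of length $2k+1$; - position $4k+3$: no square; - positions $4k+4,\dots,5k+3$: root $a^{k-1}b$ of length $k$; - positions $5k+4,\dots,6k+3$: root $a^{k-1}b\,a^{k}b\,aa$ of length $2k+3$. -/

import Mathlib

/-- A square: a word of the form `x x` with `x` nonempty. -/
def IsSquareWord {α : Type*} (v : List α) : Prop :=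
  ∃ x : List α, x ≠ [] ∧ v = x ++ x

/-- `v` occurs in `w` beginning at position `p`; positions are numbered from `1`. -/
def OccursAt {α : Type*} (v w : List α) (p : ℕ) : Prop :=
  ∃ y z : List α, w = y ++ v ++ z ∧ p = y.length + 1

/-- The last (rightmost) occurrence of `v` in `w` begins at position `p`. -/
def LastOccursAt {α : Type*} (v w : List α) (p : ℕ) : Prop :=
  OccursAt v w p ∧ ∀ q : ℕ, OccursAt v w q → q ≤ p

/-- The set of squares whose last occurrence in `w` begins at position `p`. -/
def squaresAt {α : Type*} (w : List α) (p : ℕ) : Set (List α) :=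
  {v | IsSquareWord v ∧ LastOccursAt v w p}

/-- There are finitely many such squares, so that counting them with `Set.ncard` is meaningful. -/
theorem squaresAt_finite {α : Type*} (w : List α) (p : ℕ) : (squaresAt w p).Finite := by
  refine (List.finite_toSet w.sublists).subset ?_
  rintro v ⟨-, ⟨y, z, h, -⟩, -⟩
  have hv : v <:+: w := ⟨y, z, h.symm⟩
  exact List.mem_sublists.2 hv.sublist

/-- The distinct-square-sequence `s(w) = s_1 s_2 ⋯ s_n` of a word `w` of length `n`: `s_p` is the
number of distinct squares whose last occurrence in `w` begins at position `p`. -/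
noncomputable def distinctSquareSeq {α : Type*} (w : List α) : List ℕ :=
  (List.range' 1 w.length).map fun p => (squaresAt w p).ncard

/-- The power `c^n` of a letter `c`. -/
def letterPow {α : Type*} (c : α) (n : ℕ) : List α := List.replicate n c

/-- `X_k = a^{k-1}b aa^{k-1}b a^{k-1}b aa^{k-1}b aa^{k-1}b a^{k-1}b`, for `k ≥ 1`. -/
def wordX {α : Type*} (a b : α) (k : ℕ) : List α :=
  letterPow a (k - 1) ++ [b] ++ ([a] ++ letterPow a (k - 1) ++ [b]) ++
    (letterPow a (k - 1) ++ [b]) ++ ([a] ++ letterPow a (k - 1) ++ [b]) ++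
    ([a] ++ letterPow a (k - 1) ++ [b]) ++ (letterPow a (k - 1) ++ [b])

/-- The product `X_m X_{m+1} ⋯ X_{n-1}` (empty if `n ≤ m`). -/
def blocksX {α : Type*} (a b : α) (m n : ℕ) : List α :=
  (List.range' m (n - m)).flatMap (wordX a b)

/-- `Y_{i,j} = X_i X_{i+1} ⋯ X_{j-1} X_j a a^{j-1}`. -/
def wordY {α : Type*} (a b : α) (i j : ℕ) : List α :=
  blocksX a b i (j + 1) ++ ([a] ++ letterPow a (j - 1))

/-- The sequence `1^{2k+1} 0^{k+1} 1^k 0 1^{2k}`. -/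
def blockSeq (k : ℕ) : List ℕ :=
  List.replicate (2 * k + 1) 1 ++ List.replicate (k + 1) 0 ++ List.replicate k 1 ++ [0] ++
    List.replicate (2 * k) 1

/-- The table of the squares of `X_k`: the root of the square listed at position `p` of `X_k`
(`1 ≤ p ≤ 6k+3`), or `none` where no square is listed. Each row gives the root at its first
position; the roots at the following positions of the row are its successive cyclic shifts. -/
def tableRoot {α : Type*} (a b : α) (k p : ℕ) : Option (List α) :=
  if p ≤ 2 * k + 1 then
    some ((letterPow a (k - 1) ++ [b, a] ++ letterPow a (k - 1) ++ [b] ++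
      letterPow a (k - 1) ++ [b, a]).rotate (p - 1))
  else if p ≤ 3 * k + 2 then none
  else if p ≤ 4 * k + 2 then
    some ((letterPow a (k - 1) ++ [b, a] ++ letterPow a (k - 1) ++ [b]).rotate (p - (3 * k + 3)))
  else if p ≤ 4 * k + 3 then none
  else if p ≤ 5 * k + 3 then
    some ((letterPow a (k - 1) ++ [b]).rotate (p - (4 * k + 4)))
  else
    some ((letterPow a (k - 1) ++ [b] ++ letterPow a k ++ [b, a, a]).rotate (p - (5 * k + 4)))

/-! A word over a, b is encoded by its runs of a, as a^{g 0} b ⋯ b a^{g n}. The runs of Y_{i,j} have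
lengths i - 1 plus an offset that begins 0,1,0,1,1,0 and gains 1 every six runs. The final a^j is
the next term of this pattern, so Y_{i,j} is an initial piece of one infinite pattern
(`wordY_eq_runWord`).

A square whose root has t > 0 letters b occurs from run e on exactly when its interior runs equal
those of the pattern and its two outer runs fit (`occursAt_square_iff`). Growth of the offset bounds
t, and a shift by six runs only adds a constant, so what remains is a finite check on offsets,
independent of i, j, k. For each of the six starting runs in X_k, all values of t but at most one
give squares that occur again further right, no later than the run following X_{k+1}
(`runOffset_period_cases`); k < j makes that run available. For the exceptional t the interior never
recurs (`runOffset_of_rootHeight`). Squares with t = 0 are powers of a and recur in the final run.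

Hence a position with r letters a left in run e carries one square if the exceptional t exists and r
≤ g (e + t), and none otherwise (`squaresAt_runWord`). Letting e and r vary gives the table and the
counts. -/

theorem letterPow_succ {α : Type*} (c : α) (n : ℕ) : letterPow c (n + 1) = c :: letterPow c n := rfl

theorem letterPow_add {α : Type*} (c : α) (m n : ℕ) :
    letterPow c (m + n) = letterPow c m ++ letterPow c n := List.replicate_add ..

@[simp] theorem length_letterPow {α : Type*} (c : α) (n : ℕ) : (letterPow c n).length = n :=
  List.length_replicate

/-! ### Words encoded by run lengths -/

/-- The word `a^{f 0} b a^{f 1} b ⋯ b a^{f n}` with runs of lengths `f 0, …, f n`. -/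
def runWord {α : Type*} (a b : α) : (ℕ → ℕ) → ℕ → List α
  | f, 0 => letterPow a (f 0)
  | f, n + 1 => letterPow a (f 0) ++ b :: runWord a b (fun x => f (x + 1)) n

/-- The number of letters before the run with index `e` in a word with run lengths `g`. -/
def runStart (g : ℕ → ℕ) (e : ℕ) : ℕ := ∑ x ∈ Finset.range e, (g x + 1)

theorem runStart_zero (g : ℕ → ℕ) : runStart g 0 = 0 := rfl

theorem runStart_succ (g : ℕ → ℕ) (e : ℕ) : runStart g (e + 1) = runStart g e + (g e + 1) :=
  Finset.sum_range_succ _ _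

theorem runStart_succ' (g : ℕ → ℕ) (e : ℕ) :
    runStart g (e + 1) = runStart (fun x => g (x + 1)) e + (g 0 + 1) :=
  Finset.sum_range_succ' _ _

theorem runStart_strictMono (g : ℕ → ℕ) : StrictMono (runStart g) :=
  strictMono_nat_of_lt_succ fun e => by rw [runStart_succ]; omega

theorem length_runWord {α : Type*} (a b : α) (f : ℕ → ℕ) (n : ℕ) :
    (runWord a b f n).length = runStart f n + f n := by
  induction n generalizing f with
  | zero => simp [runWord, runStart]
  | succ n ih => rw [runStart_succ']; simp [runWord, ih]; omega

theorem runWord_congr {α : Type*} (a b : α) {f g : ℕ → ℕ} {n : ℕ} (h : ∀ x ≤ n, f x = g x) :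
    runWord a b f n = runWord a b g n := by
  induction n generalizing f g with
  | zero => simp [runWord, h 0]
  | succ n ih =>
    simp only [runWord]
    rw [h 0 (by omega), ih (fun x hx => h (x + 1) (by omega))]

theorem runStart_congr {f g : ℕ → ℕ} {n : ℕ} (h : ∀ x < n, f x = g x) :
    runStart f n = runStart g n :=
  Finset.sum_congr rfl fun x hx => by rw [h x (Finset.mem_range.1 hx)]

theorem exists_eq_runWord {α : Type*} (a b : α) (l : List α) (hl : ∀ x ∈ l, x = a ∨ x = b) :
    ∃ f n, l = runWord a b f n := by
  induction l with
  | nil => exact ⟨fun _ => 0, 0, rfl⟩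
  | cons c l ih =>
    obtain ⟨f, n, rfl⟩ := ih fun x hx => hl x (List.mem_cons_of_mem _ hx)
    rcases hl c List.mem_cons_self with rfl | rfl
    · refine ⟨fun x => if x = 0 then f 0 + 1 else f x, n, ?_⟩
      cases n <;> simp [runWord, letterPow_succ]
    · exact ⟨fun x => if x = 0 then 0 else f (x - 1), n + 1, by simp [runWord, letterPow]⟩

theorem mem_runWord {α : Type*} {a b : α} {f : ℕ → ℕ} {n : ℕ} {x : α}
    (hx : x ∈ runWord a b f n) : x = a ∨ x = b := by
  induction n generalizing f with
  | zero => exact Or.inl (List.eq_of_mem_replicate hx)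
  | succ n ih =>
    simp only [runWord, List.mem_append, List.mem_cons] at hx
    rcases hx with hx | hx | hx
    · exact Or.inl (List.eq_of_mem_replicate hx)
    · exact Or.inr hx
    · exact ih hx

/-- The run lengths of a concatenation: the last run of the first word, whose index is `m`, is
merged with the first run of the second word. -/
def glueRuns (f : ℕ → ℕ) (m : ℕ) (g : ℕ → ℕ) (x : ℕ) : ℕ :=
  if x < m then f x else if x = m then f m + g 0 else g (x - m)

theorem runWord_append {α : Type*} (a b : α) (f g : ℕ → ℕ) (m n : ℕ) :
    runWord a b f m ++ runWord a b g n = runWord a b (glueRuns f m g) (m + n) := by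
  induction m generalizing f with
  | zero =>
    cases n with
    | zero => simp [runWord, glueRuns, letterPow_add]
    | succ n => simp [runWord, glueRuns, letterPow_add]
  | succ m ih =>
    rw [show m + 1 + n = m + n + 1 by omega]
    simp only [runWord, List.append_assoc, List.cons_append, ih]
    congr 2
    refine runWord_congr a b fun x _ => ?_
    simp [glueRuns]

/-! ### Prefixes and occurrences in terms of runs -/

section prefixes

variable {α : Type*} {a b : α}

theorem letterPow_prefix_letterPow {s r : ℕ} : letterPow a s <+: letterPow a r ↔ s ≤ r := by
  constructor
  · intro h; simpa using h.length_le
  · intro h; exact ⟨letterPow a (r - s), by rw [← letterPow_add, Nat.add_sub_cancel' h]⟩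

theorem letterPow_prefix_append (hab : a ≠ b) {s r : ℕ} {l : List α} :
    letterPow a s <+: letterPow a r ++ b :: l ↔ s ≤ r := by
  induction s generalizing r with
  | zero => simp [letterPow]
  | succ s ih =>
    cases r with
    | zero => simp [letterPow, List.replicate_succ, List.cons_prefix_cons, hab]
    | succ r => simp [letterPow_succ, List.cons_prefix_cons, ih]

theorem append_prefix_append (hab : a ≠ b) {s r : ℕ} {l l' : List α} :
    letterPow a s ++ b :: l <+: letterPow a r ++ b :: l' ↔ s = r ∧ l <+: l' := by
  induction s generalizing r with
  | zero =>
    cases r with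
    | zero => simp [letterPow, List.cons_prefix_cons]
    | succ r => simp [letterPow, List.replicate_succ, List.cons_prefix_cons, hab.symm]
  | succ s ih =>
    cases r with
    | zero => simp [letterPow, List.replicate_succ, List.cons_prefix_cons, hab]
    | succ r => simp [letterPow_succ, List.cons_prefix_cons, ih]

theorem not_append_prefix_letterPow (hab : a ≠ b) {s r : ℕ} {l : List α} :
    ¬ letterPow a s ++ b :: l <+: letterPow a r := fun h =>
  hab (List.eq_of_mem_replicate (h.subset (by simp : b ∈ letterPow a s ++ b :: l))).symm

/-- A run closed by b must match exactly; only the last, open run of the prefix may be shorter. -/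
theorem runWord_prefix_iff (hab : a ≠ b) {f g : ℕ → ℕ} {m n : ℕ} :
    runWord a b f m <+: runWord a b g n ↔ m ≤ n ∧ (∀ x < m, f x = g x) ∧ f m ≤ g m := by
  induction m generalizing f g n with
  | zero =>
    cases n with
    | zero => simp [runWord, letterPow_prefix_letterPow]
    | succ n => simp [runWord, letterPow_prefix_append hab]
  | succ m ih =>
    cases n with
    | zero => simp [runWord, not_append_prefix_letterPow hab]
    | succ n =>
      simp only [runWord, append_prefix_append hab, ih]
      constructor
      · rintro ⟨h0, h1, h2, h3⟩
        refine ⟨by omega, fun x hx => ?_, h3⟩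
        cases x with
        | zero => exact h0
        | succ x => exact h2 x (by omega)
      · rintro ⟨h1, h2, h3⟩
        exact ⟨h2 0 (by omega), by omega, fun x hx => h2 (x + 1) (by omega), h3⟩

theorem occursAt_iff_prefix {v w : List α} {p : ℕ} :
    OccursAt v w p ↔ ∃ y, y ++ v <+: w ∧ p = y.length + 1 := by
  constructor
  · rintro ⟨y, z, h, hp⟩
    exact ⟨y, ⟨z, h.symm⟩, hp⟩
  · rintro ⟨y, ⟨z, h⟩, hp⟩
    exact ⟨y, z, h.symm, hp⟩

/-- Occurrences of a word containing `b` in a word given by its runs. -/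
theorem occursAt_runWord_iff (hab : a ≠ b) {f g : ℕ → ℕ} {m n p : ℕ} (hm : 0 < m) :
    OccursAt (runWord a b f m) (runWord a b g n) p ↔
      ∃ e, e + m ≤ n ∧ f 0 ≤ g e ∧ (∀ x, 0 < x → x < m → f x = g (e + x)) ∧
        f m ≤ g (e + m) ∧ p + f 0 = runStart g (e + 1) := by
  rw [occursAt_iff_prefix]
  constructor
  · rintro ⟨y, hy, rfl⟩
    obtain ⟨h, e, rfl⟩ := exists_eq_runWord a b y fun x hx =>
      mem_runWord (hy.subset (List.mem_append_left _ hx))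
    rw [runWord_append, runWord_prefix_iff hab] at hy
    obtain ⟨h1, h2, h3⟩ := hy
    have he := h2 e (by omega)
    have hs : runStart h e = runStart g e := runStart_congr fun x hx => by
      simpa [glueRuns, hx] using h2 x (by omega)
    simp only [glueRuns, lt_irrefl, if_false, if_true] at he
    refine ⟨e, h1, by omega, fun x h0 hx => ?_, ?_, ?_⟩
    · have := h2 (e + x) (by omega)
      simpa [glueRuns, h0.ne'] using this
    · simpa [glueRuns, hm.ne'] using h3
    · rw [length_runWord, runStart_succ, hs]; omega
  · rintro ⟨e, h1, h2, h3, h4, h5⟩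
    -- The part before the occurrence: the runs of g up to e, with f 0 letters taken off run e.
    refine ⟨runWord a b (fun x => if x = e then g e - f 0 else g x) e, ?_, ?_⟩
    · rw [runWord_append, runWord_prefix_iff hab]
      refine ⟨h1, fun x hx => ?_, ?_⟩
      · rcases lt_trichotomy x e with hxe | rfl | hxe
        · simp [glueRuns, hxe, hxe.ne]
        · simp [glueRuns, h2]
        · obtain ⟨y, rfl⟩ := Nat.exists_eq_add_of_lt hxe
          have := h3 (y + 1) (by omega) (by omega)
          simp only [glueRuns]
          rw [if_neg (by omega), if_neg (by omega), ← add_assoc] at *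
          rw [show e + y + 1 - e = y + 1 by omega, this]
      · simpa [glueRuns, hm.ne'] using h4
    · rw [length_runWord, runStart_congr (g := g) fun x hx => by simp [hx.ne]]
      rw [runStart_succ] at h5
      simp only [if_true]; omega

/-- A power of `a` occurs only inside a run. -/
theorem exists_le_run_of_occursAt_letterPow (hab : a ≠ b) {g : ℕ → ℕ} {s n p : ℕ}
    (h : OccursAt (letterPow a s) (runWord a b g n) p) : ∃ e ≤ n, s ≤ g e := by
  obtain ⟨y, hy, -⟩ := occursAt_iff_prefix.1 h
  obtain ⟨h, e, rfl⟩ := exists_eq_runWord a b y fun x hx =>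
    mem_runWord (hy.subset (List.mem_append_left _ hx))
  rw [show letterPow a s = runWord a b (fun _ => s) 0 from rfl, runWord_append,
    runWord_prefix_iff hab] at hy
  obtain ⟨h1, -, h3⟩ := hy
  simp only [glueRuns, add_zero, lt_irrefl, if_false, if_true] at h3
  exact ⟨e, h1, by omega⟩

theorem occursAt_letterPow_last_run {g : ℕ → ℕ} {s n : ℕ} (hs : s ≤ g n) :
    ∃ p, runStart g n < p ∧ OccursAt (letterPow a s) (runWord a b g n) p := by
  refine ⟨_, ?_, runWord a b (fun x => if x = n then g n - s else g x) n, [], ?_, rfl⟩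
  · rw [length_runWord, runStart_congr (f := fun x => if x = n then g n - s else g x) (g := g)
      fun x hx => by simp [hx.ne]]
    omega
  · rw [show letterPow a s = runWord a b (fun _ => s) 0 from rfl, runWord_append, List.append_nil]
    refine runWord_congr a b fun x hx => ?_
    rcases (show x ≤ n from hx).lt_or_eq with h | rfl
    · simp [glueRuns, h, h.ne]
    · simp [glueRuns, hs]

end prefixes

/-! ### The run pattern of Y_{i,j} -/

/-- The run lengths of `X_1 X_2 ⋯`, with the initial run counted as `0`. -/
def runOffset (m : ℕ) : ℕ := m / 6 + if m % 6 = 1 ∨ m % 6 = 3 ∨ m % 6 = 4 then 1 else 0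

theorem runOffset_six_mul_add (q m : ℕ) : runOffset (6 * q + m) = q + runOffset m := by
  unfold runOffset
  rw [show (6 * q + m) % 6 = m % 6 by omega]
  omega

theorem div_six_le_runOffset (m : ℕ) : m / 6 ≤ runOffset m := Nat.le_add_right _ _

theorem runOffset_le (m : ℕ) : runOffset m ≤ m / 6 + 1 := by
  unfold runOffset; split_ifs <;> omega

/-- The run lengths of `Y_{i,j}`. -/
def runLen (i m : ℕ) : ℕ := i - 1 + runOffset m

theorem runLen_six_mul_add (i q m : ℕ) : runLen i (6 * q + m) = runLen i 0 + q + runOffset m := by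
  simp [runLen, runOffset_six_mul_add, show runOffset 0 = 0 from rfl, add_assoc]

/-- The final run is the longest: before index 6N the quotient by 6 is below N and the extra term is
at most 1. -/
theorem runLen_le_of_le {i N e : ℕ} (he : e ≤ 6 * N) : runLen i e ≤ runLen i (6 * N) := by
  have h := runLen_six_mul_add i N 0
  rw [add_zero, show runOffset 0 = 0 from rfl] at h
  rcases he.lt_or_eq with he | rfl
  · have := runOffset_le e
    rw [h]; simp only [runLen, show runOffset 0 = 0 from rfl]; omega
  · exact le_rfl

/-! ### Squares and their last occurrences -/

section squares

variable {α : Type*} {a b : α}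

/-- The square of `a^{f 0} b ⋯ b a^{f t}` matches the runs `g 0, …, g n` from the run `e` on. -/
def SquareMatches (g : ℕ → ℕ) (n : ℕ) (f : ℕ → ℕ) (t e : ℕ) : Prop :=
  e + 2 * t ≤ n ∧ f 0 ≤ g e ∧ (∀ x, 0 < x → x < t → f x = g (e + x)) ∧ f t + f 0 = g (e + t) ∧
    (∀ x, 0 < x → x < t → f x = g (e + t + x)) ∧ f t ≤ g (e + 2 * t)

theorem occursAt_square_iff (hab : a ≠ b) {f g : ℕ → ℕ} {t n p : ℕ} (ht : 0 < t) :
    OccursAt (runWord a b f t ++ runWord a b f t) (runWord a b g n) p ↔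
      ∃ e, SquareMatches g n f t e ∧ p + f 0 = runStart g (e + 1) := by
  rw [runWord_append, occursAt_runWord_iff hab (by omega)]
  refine exists_congr fun e => ?_
  have h0 : glueRuns f t f 0 = f 0 := by simp [glueRuns, ht]
  have ht2 : glueRuns f t f (t + t) = f t := by simp [glueRuns, ht.ne']
  rw [h0, ht2]
  constructor
  · rintro ⟨h1, h2, h3, h4, h5⟩
    refine ⟨⟨by omega, h2, fun x hx hxt => ?_, ?_, fun x hx hxt => ?_, ?_⟩, h5⟩
    · simpa [glueRuns, hxt] using h3 x hx (by omega)
    · simpa [glueRuns] using h3 t ht (by omega)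
    · simpa [glueRuns, hx.ne', add_assoc] using h3 (t + x) (by omega) (by omega)
    · rwa [two_mul]
  · rintro ⟨⟨h1, h2, h3, h4, h5, h6⟩, h7⟩
    refine ⟨by omega, h2, fun x hx hxt => ?_, by rwa [two_mul] at h6, h7⟩
    rcases lt_trichotomy x t with hlt | rfl | hlt
    · simpa [glueRuns, hlt] using h3 x hx hlt
    · simpa [glueRuns] using h4
    · obtain ⟨y, rfl⟩ := Nat.exists_eq_add_of_lt hlt
      have := h5 (y + 1) (by omega) (by omega)
      rw [glueRuns, if_neg (by omega), if_neg (by omega), show t + y + 1 - t = y + 1 by omega, this,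
        ← add_assoc, ← add_assoc, ← add_assoc]

/-- With f 0 fixed, the position increases strictly with e, so the rightmost occurrence is the one
with the largest e. -/
theorem lastOccursAt_square_iff (hab : a ≠ b) {f g : ℕ → ℕ} {t n p : ℕ} (ht : 0 < t) :
    LastOccursAt (runWord a b f t ++ runWord a b f t) (runWord a b g n) p ↔
      ∃ e, SquareMatches g n f t e ∧ p + f 0 = runStart g (e + 1) ∧
        ∀ e', SquareMatches g n f t e' → e' ≤ e := by
  have key : ∀ e, SquareMatches g n f t e → f 0 ≤ runStart g (e + 1) := fun e he => by
    have := he.2.1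
    rw [runStart_succ]; omega
  simp only [LastOccursAt, occursAt_square_iff hab ht]
  constructor
  · rintro ⟨⟨e, he, hp⟩, h⟩
    refine ⟨e, he, hp, fun e' he' => ?_⟩
    have h1 := h (runStart g (e' + 1) - f 0) ⟨e', he', Nat.sub_add_cancel (key e' he')⟩
    have h2 := key e' he'
    have : runStart g (e' + 1) ≤ runStart g (e + 1) := by omega
    have := (runStart_strictMono g).le_iff_le.1 this
    omega
  · rintro ⟨e, he, hp, h⟩
    refine ⟨⟨e, he, hp⟩, ?_⟩
    rintro p' ⟨e', he', hp'⟩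
    have := (runStart_strictMono g).monotone (Nat.succ_le_succ (h e' he'))
    simp only [Nat.succ_eq_add_one] at this
    omega

/-- The number of letters `b` in the root of the squares whose last occurrence begins in the run
with index `e` of a block. -/
def rootHeight (e : ℕ) : Option ℕ :=
  if e ≤ 1 then some 3 else if e = 2 then none else if e = 4 then some 1 else some 2

-- Eliminates every other t: at e' the interior runs are the same and the outer runs at least as
-- long, so any square matching at e matches again at e'.
set_option synthInstance.maxHeartbeats 400000 in
set_option synthInstance.maxSize 4000 in
set_option maxRecDepth 100000 in
theorem runOffset_period_cases :
    ∀ e < 6, ∀ t < 13, 0 < t → (∀ x < t, 0 < x → runOffset (e + x) = runOffset (e + t + x)) →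
      rootHeight e = some t ∨
        ∃ e' < 8, e < e' ∧ e' + 2 * t ≤ 12 ∧ runOffset e ≤ runOffset e' ∧
          (∀ x < 2 * t, 0 < x → runOffset (e' + x) = runOffset (e + x)) ∧
          runOffset (e + 2 * t) ≤ runOffset (e' + 2 * t) := by
  decide

-- Run e + 2t is at least as long as run e + t, so the end of the square always fits; and the
-- interior runs already forbid a later match.
set_option synthInstance.maxHeartbeats 400000 in
set_option synthInstance.maxSize 4000 in
set_option maxRecDepth 100000 in
theorem runOffset_of_rootHeight :
    ∀ e < 6, ∀ t < 4, rootHeight e = some t → 0 < t ∧ e + 2 * t ≤ 12 ∧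
      (∀ x < t, 0 < x → runOffset (e + x) = runOffset (e + t + x)) ∧
      runOffset (e + t) ≤ runOffset (e + 2 * t) ∧
      ∀ y < 18, e < y → ¬ ∀ x < 2 * t, 0 < x → runOffset (y + x) = runOffset (e + x) := by
  decide

/-- The run lengths of the root with `t` letters `b` of a square that begins with the last `r`
letters `a` of the run `e`. -/
def rootRuns (g : ℕ → ℕ) (e r t : ℕ) (x : ℕ) : ℕ :=
  if x = 0 then r else if x < t then g (e + x) else g (e + t) - r

theorem squaresAt_runWord_subset (hab : a ≠ b) {i N q e r p : ℕ} (hq : q + 2 ≤ N) (he : e < 6)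
    (hr : r ≤ runLen i (6 * q + e)) (hp : p + r = runStart (runLen i) (6 * q + e + 1))
    {v : List α} (hv : v ∈ squaresAt (runWord a b (runLen i) (6 * N)) p) :
    ∃ t ∈ rootHeight e, r ≤ runLen i (6 * q + e + t) ∧
      v = runWord a b (rootRuns (runLen i) (6 * q + e) r t) t ++
        runWord a b (rootRuns (runLen i) (6 * q + e) r t) t := by
  obtain ⟨⟨u, -, rfl⟩, hlast⟩ := hv
  obtain ⟨f, t, rfl⟩ := exists_eq_runWord a b u fun x hx => by
    obtain ⟨y, z, h, -⟩ := hlast.1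
    exact mem_runWord (by rw [h]; simp [hx])
  rcases Nat.eq_zero_or_pos t with rfl | ht
  · exfalso
    rw [runWord, ← letterPow_add] at hlast
    obtain ⟨e', he', hle⟩ := exists_le_run_of_occursAt_letterPow hab hlast.1
    obtain ⟨p', hp', hocc⟩ :=
      occursAt_letterPow_last_run (a := a) (b := b) (hle.trans (runLen_le_of_le he'))
    have h1 := hlast.2 p' hocc
    have h2 := (runStart_strictMono (runLen i)).monotone (show 6 * q + e + 1 ≤ 6 * N by omega)
    omega
  obtain ⟨e', hm, hpe, hmax⟩ := (lastOccursAt_square_iff hab ht).1 hlast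
  -- The position p lies in a run or on the b closing it, which determines the index of the run.
  obtain rfl : e' = 6 * q + e := by
    have h0 := hm.2.1
    have h1 := runStart_succ (runLen i) e'
    have h2 := runStart_succ (runLen i) (6 * q + e)
    rcases lt_trichotomy e' (6 * q + e) with h | h | h
    · have := (runStart_strictMono (runLen i)).monotone (show e' + 1 ≤ 6 * q + e by omega)
      omega
    · exact h
    · have := (runStart_strictMono (runLen i)).monotone (show 6 * q + e + 1 ≤ e' by omega)
      omega
  obtain rfl : f 0 = r := by omega
  obtain ⟨-, -, h3, h4, h5, h6⟩ := hm
  have hper : ∀ x < t, 0 < x → runOffset (e + x) = runOffset (e + t + x) := fun x hx h0 => by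
    have := (h3 x h0 hx).symm.trans (h5 x h0 hx)
    rw [show 6 * q + e + t + x = 6 * q + (e + t + x) by ring, add_assoc, runLen_six_mul_add,
      runLen_six_mul_add] at this
    omega
  -- The offset at m is m/6 or m/6 + 1, and thirteen steps raise m/6 by at least 2, so run e + 1
  -- cannot reappear at e + t + 1.
  have htb : t < 13 := by
    by_contra! h
    have h1 := hper 1 (by omega) one_pos
    have h2 := runOffset_le (e + 1)
    have h3 := div_six_le_runOffset (e + t + 1)
    omega
  refine ⟨t, ?_, by omega, ?_⟩
  · rcases runOffset_period_cases e he t htb ht hper with h | ⟨e', -, h7, h8, h9, h10, h11⟩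
    · exact h
    · exfalso
      have key : ∀ x, 0 < x → x < 2 * t →
          runLen i (6 * q + e' + x) = runLen i (6 * q + e + x) := fun x h0 hx => by
        rw [add_assoc, add_assoc, runLen_six_mul_add, runLen_six_mul_add, h10 x hx h0]
      have := hmax (6 * q + e') ⟨by omega, hr.trans ?_, fun x h0 hx => ?_, ?_, fun x h0 hx => ?_,
        h6.trans ?_⟩
      · omega
      · rw [runLen_six_mul_add, runLen_six_mul_add]; omega
      · rw [h3 x h0 hx, key x h0 (by omega)]
      · rw [h4, key t ht (by omega)]
      · rw [h5 x h0 hx, add_assoc _ t x, add_assoc _ t x, key (t + x) (by omega) (by omega)]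
      · rw [add_assoc, add_assoc, runLen_six_mul_add, runLen_six_mul_add]; omega
  · rw [runWord_congr a b (f := rootRuns (runLen i) (6 * q + e) (f 0) t) (g := f) fun x hx => ?_]
    unfold rootRuns
    split_ifs with hx0 hxt
    · rw [hx0]
    · exact (h3 x (by omega) hxt).symm
    · rw [show x = t by omega]; omega

theorem mem_squaresAt_runWord (hab : a ≠ b) {i N q e r p t : ℕ} (hq : q + 2 ≤ N) (he : e < 6)
    (hr : r ≤ runLen i (6 * q + e)) (hp : p + r = runStart (runLen i) (6 * q + e + 1))
    (ht : t ∈ rootHeight e) (hrt : r ≤ runLen i (6 * q + e + t)) :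
    runWord a b (rootRuns (runLen i) (6 * q + e) r t) t ++
        runWord a b (rootRuns (runLen i) (6 * q + e) r t) t ∈
      squaresAt (runWord a b (runLen i) (6 * N)) p := by
  have ht4 : t < 4 := by
    unfold rootHeight at ht
    split_ifs at ht <;> simp at ht <;> omega
  obtain ⟨h0, h12, hper, hle, hlast⟩ := runOffset_of_rootHeight e he t ht4 ht
  set f := rootRuns (runLen i) (6 * q + e) r t with hf
  have hf0 : f 0 = r := by simp [hf, rootRuns]
  have hfx : ∀ x, 0 < x → x < t → f x = runLen i (6 * q + e + x) := fun x hx hxt => by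
    simp [hf, rootRuns, hx.ne', hxt]
  have hft : f t = runLen i (6 * q + e + t) - r := by simp [hf, rootRuns, h0.ne']
  refine ⟨⟨_, ?_, rfl⟩, (lastOccursAt_square_iff hab h0).2 ⟨6 * q + e, ?_, by rw [hf0, hp], ?_⟩⟩
  · obtain ⟨s, rfl⟩ := Nat.exists_eq_add_of_lt h0
    simp [runWord]
  · refine ⟨by omega, by rwa [hf0], hfx, by omega, fun x hx hxt => ?_, ?_⟩
    · rw [hfx x hx hxt, show 6 * q + e + t + x = 6 * q + (e + t + x) by ring, add_assoc,
        runLen_six_mul_add, runLen_six_mul_add, hper x hxt hx]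
    · rw [hft]
      refine (Nat.sub_le _ _).trans ?_
      rw [add_assoc, add_assoc, runLen_six_mul_add, runLen_six_mul_add]; omega
  · rintro e' ⟨-, -, g3, g4, g5, -⟩
    by_contra! hlt
    obtain ⟨y, rfl⟩ := Nat.exists_eq_add_of_le (show 6 * q ≤ e' by omega)
    -- A later match would reproduce all interior runs: first copy, merged run at x = t, second
    -- copy.
    have key : ∀ x < 2 * t, 0 < x → runOffset (y + x) = runOffset (e + x) := fun x hx hx0 => by
      suffices runLen i (6 * q + y + x) = runLen i (6 * q + e + x) by
        rw [add_assoc, add_assoc, runLen_six_mul_add, runLen_six_mul_add] at this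
        omega
      rcases lt_trichotomy x t with h | rfl | h
      · rw [← g3 x hx0 h, hfx x hx0 h]
      · omega
      · obtain ⟨z, rfl⟩ := Nat.exists_eq_add_of_lt h
        have h1 := g5 (z + 1) (by omega) (by omega)
        rw [hfx (z + 1) (by omega) (by omega)] at h1
        rw [add_assoc t, ← add_assoc _ t, ← h1, show 6 * q + e + (t + (z + 1)) =
          6 * q + (e + t + (z + 1)) by ring, add_assoc, runLen_six_mul_add, runLen_six_mul_add,
          hper (z + 1) (by omega) (by omega)]
    -- For y ≥ 18 the offset at y + 1 is at least 3, while at e + 1 it is at most 2.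
    refine hlast y ?_ (by omega) key
    have h1 := key 1 (by omega) one_pos
    have h2 := runOffset_le (e + 1)
    have h3 := div_six_le_runOffset (y + 1)
    omega

theorem squaresAt_runWord (hab : a ≠ b) {i N q e r p : ℕ} (hq : q + 2 ≤ N) (he : e < 6)
    (hr : r ≤ runLen i (6 * q + e)) (hp : p + r = runStart (runLen i) (6 * q + e + 1)) :
    squaresAt (runWord a b (runLen i) (6 * N)) p =
      {v | ∃ t ∈ rootHeight e, r ≤ runLen i (6 * q + e + t) ∧
        v = runWord a b (rootRuns (runLen i) (6 * q + e) r t) t ++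
          runWord a b (rootRuns (runLen i) (6 * q + e) r t) t} := by
  ext v
  refine ⟨squaresAt_runWord_subset hab hq he hr hp, ?_⟩
  rintro ⟨t, ht, hrt, rfl⟩
  exact mem_squaresAt_runWord hab hq he hr hp ht hrt

end squares

/-! ### Products of the blocks as run words -/

section blocks

variable {α : Type*} (a b : α)

theorem blocksX_self (m : ℕ) : blocksX a b m m = [] := by simp [blocksX]

theorem blocksX_append {i k n : ℕ} (hik : i ≤ k) (hkn : k ≤ n) :
    blocksX a b i k ++ blocksX a b k n = blocksX a b i n := by
  unfold blocksX
  rw [← List.flatMap_append]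
  congr 1
  obtain ⟨s, rfl⟩ := Nat.exists_eq_add_of_le hik
  obtain ⟨t, rfl⟩ := Nat.exists_eq_add_of_le hkn
  rw [show i + s - i = s by omega, show i + s + t - (i + s) = t by omega,
    show i + s + t - i = s + t by omega, ← List.range'_append (step := 1), one_mul]

theorem blocksX_succ (k : ℕ) : blocksX a b k (k + 1) = wordX a b k := by
  simp [blocksX]

theorem length_wordX {k : ℕ} (hk : 1 ≤ k) : (wordX a b k).length = 6 * k + 3 := by
  simp [wordX]; omega

theorem runLen_zero (i : ℕ) : runLen i 0 = i - 1 := by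
  simp [runLen, show runOffset 0 = 0 from rfl]

/-- X_m supplies six runs closed by b, and the pattern for m shifted by six runs is the pattern for
m + 1. -/
theorem wordX_append_runWord {m : ℕ} (hm : 1 ≤ m) (n : ℕ) :
    wordX a b m ++ runWord a b (runLen (m + 1)) n = runWord a b (runLen m) (n + 6) := by
  obtain ⟨m, rfl⟩ := Nat.exists_eq_add_of_le' hm
  have h : (fun x => runLen (m + 1) (x + 1 + 1 + 1 + 1 + 1 + 1)) = runLen (m + 1 + 1) := by
    funext x
    rw [show x + 1 + 1 + 1 + 1 + 1 + 1 = 6 * 1 + x by ring, runLen_six_mul_add, runLen_zero]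
    simp [runLen]
  simp only [runWord, h]
  simp [wordX, runLen, runOffset, letterPow_succ]

/-- The added a^{n-1} is the opening run of X_n, so the pattern continues through it. -/
theorem blocksX_append_letterPow {i n : ℕ} (hi : 1 ≤ i) (hin : i ≤ n) :
    blocksX a b i n ++ letterPow a (n - 1) = runWord a b (runLen i) (6 * (n - i)) := by
  obtain ⟨s, rfl⟩ := Nat.exists_eq_add_of_le hin
  induction s generalizing i with
  | zero => simp [blocksX_self, runWord, runLen_zero]
  | succ s ih =>
    rw [← blocksX_append a b (show i ≤ i + 1 by omega) (by omega), blocksX_succ, List.append_assoc,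
      show i + (s + 1) = i + 1 + s by omega, ih (by omega) (by omega), wordX_append_runWord a b hi]
    congr 1
    omega

theorem length_blocksX {i k : ℕ} (hi : 1 ≤ i) (hik : i ≤ k) :
    (blocksX a b i k).length = runStart (runLen i) (6 * (k - i)) := by
  have h := congrArg List.length (blocksX_append_letterPow a b hi hik)
  have h0 := runLen_six_mul_add i (k - i) 0
  rw [runLen_zero, add_zero, show runOffset 0 = 0 from rfl] at h0
  rw [length_runWord, List.length_append, length_letterPow] at h
  omega

theorem wordY_eq_runWord {i j : ℕ} (hi : 1 ≤ i) (hij : i ≤ j) :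
    wordY a b i j = runWord a b (runLen i) (6 * (j + 1 - i)) := by
  rw [← blocksX_append_letterPow a b hi (by omega), wordY, Nat.add_sub_cancel]
  obtain ⟨s, rfl⟩ := Nat.exists_eq_add_of_le' (hi.trans hij)
  simp [letterPow_succ]

theorem rotate_append_of_length_eq {n : ℕ} {l l' : List α} (h : l.length = n) :
    (l ++ l').rotate n = l' ++ l := by
  rw [← h, List.rotate_append_length_eq]

end blocks

/-! ### The table in terms of runs -/

section table

variable {α : Type*} (a b : α)

variable {k p r s : ℕ}

/-- The rotation by s cuts the leading a^{k-1} as a^s a^r and moves a^s to the end. Runs 3, 4, 5 are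
handled in the same way. -/
theorem tableRoot_run_zero (hk : k = s + r + 1) (hp : p = s + 1) :
    tableRoot a b k p = some (letterPow a r ++ b :: (letterPow a k ++
      b :: (letterPow a (k - 1) ++ b :: letterPow a (s + 1)))) := by
  subst hk hp
  rw [tableRoot, if_pos (by omega), Nat.add_sub_cancel, Nat.add_sub_cancel, letterPow_add a s r]
  simp only [List.append_assoc]
  rw [rotate_append_of_length_eq (by simp)]
  simp [letterPow_succ, letterPow_add]

/-- The first row goes on into run 1: the rotation by k + s passes a^{k-1} b and cuts the a^k after
it. -/
theorem tableRoot_run_one (hk : k = s + r) (hk1 : 1 ≤ k) (hp : p = k + s + 1) :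
    tableRoot a b k p = some (letterPow a r ++ b :: (letterPow a (k - 1) ++
      b :: (letterPow a k ++ b :: letterPow a s))) := by
  have h : a :: letterPow a (k - 1) = letterPow a s ++ letterPow a r := by
    rw [← letterPow_succ, Nat.sub_add_cancel hk1, hk, letterPow_add]
  have hk' : letterPow a k = a :: letterPow a (k - 1) := by
    rw [← letterPow_succ, Nat.sub_add_cancel hk1]
  have hw : letterPow a (k - 1) ++ [b, a] ++ letterPow a (k - 1) ++ [b] ++ letterPow a (k - 1) ++
      [b, a] = (letterPow a (k - 1) ++ b :: letterPow a s) ++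
        (letterPow a r ++ b :: (letterPow a (k - 1) ++ [b, a])) := by
    have : letterPow a (k - 1) ++ [b, a] ++ letterPow a (k - 1) ++ [b] ++ letterPow a (k - 1) ++
      [b, a] = letterPow a (k - 1) ++ b :: ((a :: letterPow a (k - 1)) ++
        b :: (letterPow a (k - 1) ++ [b, a])) := by simp
    rw [this, h]; simp
  rw [tableRoot, if_pos (by omega), hw, rotate_append_of_length_eq (by simp; omega), hk']
  simp

/-- This range is all of run 2 together with the first position of run 3. -/
theorem tableRoot_run_two (hk : 2 * k + 1 < p) (hp : p ≤ 3 * k + 2) :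
    tableRoot a b k p = none := by
  rw [tableRoot, if_neg (by omega), if_pos hp]

theorem tableRoot_run_three (hk : k = s + r + 1) (hp : p = 3 * k + 3 + s) :
    tableRoot a b k p = some (letterPow a r ++ b :: (letterPow a k ++ b :: letterPow a s)) := by
  rw [tableRoot, if_neg (by omega), if_neg (by omega), if_pos (by omega), hp,
    Nat.add_sub_cancel_left, hk, Nat.add_sub_cancel, letterPow_add a s r]
  simp only [List.append_assoc]
  rw [rotate_append_of_length_eq (by simp)]
  simp [letterPow_succ, letterPow_add]

theorem tableRoot_run_four (hk : k = s + r + 1) (hp : p = 4 * k + 4 + s) :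
    tableRoot a b k p = some (letterPow a r ++ b :: letterPow a s) := by
  rw [tableRoot, if_neg (by omega), if_neg (by omega), if_neg (by omega), if_neg (by omega),
    if_pos (by omega), hp, Nat.add_sub_cancel_left, hk, Nat.add_sub_cancel, letterPow_add a s r]
  simp only [List.append_assoc]
  rw [rotate_append_of_length_eq (by simp)]
  simp

theorem tableRoot_run_five (hk : k = s + r + 1) (hp : p = 5 * k + 4 + s) :
    tableRoot a b k p =
      some (letterPow a r ++ b :: (letterPow a k ++ b :: letterPow a (s + 2))) := by
  rw [tableRoot, if_neg (by omega), if_neg (by omega), if_neg (by omega), if_neg (by omega),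
    if_neg (by omega), hp, Nat.add_sub_cancel_left, hk, Nat.add_sub_cancel, letterPow_add a s r]
  simp only [List.append_assoc]
  rw [rotate_append_of_length_eq (by simp)]
  simp [letterPow_succ, letterPow_add]

theorem tableRoot_last_of_run_four (hp : p = 4 * k + 3) : tableRoot a b k p = none := by
  rw [tableRoot, if_neg (by omega), if_neg (by omega), if_neg (by omega), if_pos (by omega)]

end table

/-! ### The squares beginning in X_k -/

/-- The run lengths of `X_k X_{k+1} ⋯`. -/
def blockRuns (k x : ℕ) : ℕ := k - 1 + runOffset x

section blockRuns

variable {α : Type*} {a b : α} {i j k p e r : ℕ}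

theorem runLen_block (hi : 1 ≤ i) (hik : i ≤ k) (e : ℕ) :
    runLen i (6 * (k - i) + e) = blockRuns k e := by
  rw [runLen_six_mul_add, runLen_zero, blockRuns]; omega

theorem runStart_block (hi : 1 ≤ i) (hik : i ≤ k) (e : ℕ) :
    runStart (runLen i) (6 * (k - i) + e) =
      runStart (runLen i) (6 * (k - i)) + runStart (blockRuns k) e := by
  rw [runStart, Finset.sum_range_add]
  simp only [runLen_block hi hik]; rfl

theorem squaresAt_wordY_of_run (hab : a ≠ b) (hi : 1 ≤ i) (hik : i ≤ k) (hkj : k < j) (he : e < 6)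
    (hr : r ≤ blockRuns k e) (hp : p + r = runStart (blockRuns k) (e + 1)) :
    squaresAt (wordY a b i j) ((blocksX a b i k).length + p) =
      {v | ∃ t ∈ rootHeight e, r ≤ blockRuns k (e + t) ∧
        v = runWord a b (rootRuns (blockRuns k) e r t) t ++
          runWord a b (rootRuns (blockRuns k) e r t) t} := by
  rw [wordY_eq_runWord a b hi (by omega), length_blocksX a b hi hik,
    squaresAt_runWord hab (q := k - i) (e := e) (r := r) (by omega) he
      (by rwa [runLen_block hi hik])
      (by rw [add_assoc (6 * (k - i)), runStart_block hi hik]; omega)]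
  have hruns : rootRuns (runLen i) (6 * (k - i) + e) r = rootRuns (blockRuns k) e r := by
    funext t x
    simp only [rootRuns, add_assoc, runLen_block hi hik]
  simp only [add_assoc, runLen_block hi hik, hruns]

theorem squaresAt_wordY_of_tableRoot_eq_some (hab : a ≠ b) (hi : 1 ≤ i) (hik : i ≤ k) (hkj : k < j)
    (he : e < 6) {t : ℕ} (ht : t ∈ rootHeight e) (hr : r ≤ blockRuns k e)
    (hrt : r ≤ blockRuns k (e + t)) (hp : p + r = runStart (blockRuns k) (e + 1))
    (hu : tableRoot a b k p = some (runWord a b (rootRuns (blockRuns k) e r t) t)) :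
    squaresAt (wordY a b i j) ((blocksX a b i k).length + p) =
      {v | ∃ u ∈ tableRoot a b k p, v = u ++ u} := by
  rw [squaresAt_wordY_of_run hab hi hik hkj he hr hp, hu, Option.mem_def.1 ht]
  simp [hrt]

theorem squaresAt_wordY_of_tableRoot_eq_none (hab : a ≠ b) (hi : 1 ≤ i) (hik : i ≤ k) (hkj : k < j)
    (he : e < 6) (hr : r ≤ blockRuns k e) (hrt : ∀ t ∈ rootHeight e, blockRuns k (e + t) < r)
    (hp : p + r = runStart (blockRuns k) (e + 1)) (hu : tableRoot a b k p = none) :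
    squaresAt (wordY a b i j) ((blocksX a b i k).length + p) =
      {v | ∃ u ∈ tableRoot a b k p, v = u ++ u} := by
  rw [squaresAt_wordY_of_run hab hi hik hkj he hr hp, hu]
  ext v
  simp only [Set.mem_ofPred_eq, reduceCtorEq, Option.mem_def, false_and, exists_false, iff_false]
  rintro ⟨t, ht, hle, -⟩
  exact (hrt t ht).not_ge hle

end blockRuns

set_option maxHeartbeats 2000000 in
theorem squaresAt_wordY {α : Type*} {a b : α} (hab : a ≠ b) {i j k p : ℕ} (hi : 1 ≤ i)
    (hik : i ≤ k) (hkj : k < j) (hp1 : 1 ≤ p) (hp : p ≤ 6 * k + 3) :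
    squaresAt (wordY a b i j) ((blocksX a b i k).length + p) =
      {v : List α | ∃ u ∈ tableRoot a b k p, v = u ++ u} := by
  have some_case := fun e he t ht r =>
    squaresAt_wordY_of_tableRoot_eq_some (p := p) (e := e) (t := t) (r := r) hab hi hik hkj he ht
  have none_case := fun e he r =>
    squaresAt_wordY_of_tableRoot_eq_none (p := p) (e := e) (r := r) hab hi hik hkj he
  -- Writing k = m + 1 removes the truncated subtraction; only the run lengths 0 to 7 are needed
  -- below.
  obtain ⟨m, rfl⟩ := Nat.exists_eq_add_of_le' (hi.trans hik)
  have hg0 : blockRuns (m + 1) 0 = m := rfl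
  have hg1 : blockRuns (m + 1) 1 = m + 1 := rfl
  have hg2 : blockRuns (m + 1) 2 = m := rfl
  have hg3 : blockRuns (m + 1) 3 = m + 1 := rfl
  have hg4 : blockRuns (m + 1) 4 = m + 1 := rfl
  have hg5 : blockRuns (m + 1) 5 = m := rfl
  have hg6 : blockRuns (m + 1) 6 = m + 1 := rfl
  have hg7 : blockRuns (m + 1) 7 = m + 2 := rfl
  clear hi hik hkj
  generalize blockRuns (m + 1) = g at *
  have hS1 : runStart g 1 = (m + 1) := by rw [runStart_succ, runStart_zero, hg0]; omega
  have hS2 : runStart g 2 = 2 * (m + 1) + 1 := by rw [runStart_succ, hS1, hg1]; omega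
  have hS3 : runStart g 3 = 3 * (m + 1) + 1 := by rw [runStart_succ, hS2, hg2]; omega
  have hS4 : runStart g 4 = 4 * (m + 1) + 2 := by rw [runStart_succ, hS3, hg3]; omega
  have hS5 : runStart g 5 = 5 * (m + 1) + 2 + 1 := by rw [runStart_succ, hS4, hg4]; omega
  have hS6 : runStart g 6 = 6 * (m + 1) + 3 := by rw [runStart_succ, hS5, hg5]; omega
  -- The cases follow the six runs. Runs 3 and 4 lose their first position: there r = k, but e + t =
  -- 5 and run 5 has length k - 1.
  rcases le_or_gt p (m + 1) with h1 | h1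
  · refine some_case 0 (by omega) 3 rfl ((m + 1) - p) (by omega)
      (show _ ≤ g 3 by omega) (by rw [hS1]; omega) ?_
    rw [tableRoot_run_zero a b (r := (m + 1) - p) (s := p - 1) (by omega) (by omega)]
    simp [runWord, rootRuns, hg1, hg2, hg3]
    congr 1; omega
  rcases le_or_gt p (2 * (m + 1) + 1) with h2 | h2
  · refine some_case 1 (by omega) 3 rfl (2 * (m + 1) + 1 - p) (by omega)
      (show _ ≤ g 4 by omega) (by rw [hS2]; omega) ?_
    rw [tableRoot_run_one a b (r := 2 * (m + 1) + 1 - p)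
      (s := p - ((m + 1) + 1)) (by omega) (by omega)
      (by omega)]
    simp [runWord, rootRuns, hg2, hg3, hg4]
    congr 1; omega
  rcases le_or_gt p (3 * (m + 1) + 1) with h3 | h3
  · refine none_case 2 (by omega) (3 * (m + 1) + 1 - p) (by omega)
      (by simp [rootHeight]) (by rw [hS3]; omega) ?_
    exact tableRoot_run_two a b (by omega) (by omega)
  rcases le_or_gt p (3 * (m + 1) + 2) with h4 | h4
  · refine none_case 3 (by omega) (m + 1) (by omega)
      (fun t ht => by obtain rfl := Option.some_inj.1 ht; exact hg5.trans_lt (by omega))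
      (by rw [hS4]; omega) ?_
    exact tableRoot_run_two a b (by omega) (by omega)
  rcases le_or_gt p (4 * (m + 1) + 2) with h5 | h5
  · refine some_case 3 (by omega) 2 rfl (4 * (m + 1) + 2 - p) (by omega)
      (show _ ≤ g 5 by omega) (by rw [hS4]; omega) ?_
    rw [tableRoot_run_three a b (r := 4 * (m + 1) + 2 - p)
      (s := p - (3 * (m + 1) + 3)) (by omega) (by omega)]
    simp [runWord, rootRuns, hg4, hg5]
    congr 1; omega
  rcases le_or_gt p (4 * (m + 1) + 3) with h6 | h6
  · refine none_case 4 (by omega) (m + 1) (by omega)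
      (fun t ht => by obtain rfl := Option.some_inj.1 ht; exact hg5.trans_lt (by omega))
      (by rw [hS5]; omega) ?_
    exact tableRoot_last_of_run_four a b (by omega)
  rcases le_or_gt p (5 * (m + 1) + 3) with h7 | h7
  · refine some_case 4 (by omega) 1 rfl (5 * (m + 1) + 3 - p) (by omega)
      (show _ ≤ g 5 by omega) (by rw [hS5]; omega) ?_
    rw [tableRoot_run_four a b (r := 5 * (m + 1) + 3 - p)
      (s := p - (4 * (m + 1) + 4)) (by omega) (by omega)]
    simp [runWord, rootRuns, hg5]
    congr 1; omega
  · refine some_case 5 (by omega) 2 rfl (6 * (m + 1) + 3 - p) (by omega)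
      (show _ ≤ g 7 by omega) (by rw [hS6]; omega) ?_
    rw [tableRoot_run_five a b (r := 6 * (m + 1) + 3 - p)
      (s := p - (5 * (m + 1) + 4)) (by omega) (by omega)]
    simp [runWord, rootRuns, hg6, hg7]
    congr 1; omega

/-! ### Counting -/

section counting

variable {α : Type*}

theorem squaresAt_disjoint (w : List α) {p q : ℕ} (h : p ≠ q) :
    Disjoint (squaresAt w p) (squaresAt w q) := by
  rw [Set.disjoint_left]
  rintro v ⟨-, hp⟩ ⟨-, hq⟩
  exact h (le_antisymm (hq.2 p hp.1) (hp.2 q hq.1))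

/-- A word has only one last position, so the counts add up. The induction carries finiteness along
because `Set.ncard` is additive only for finite sets. -/
theorem ncard_exists_mem_squaresAt (w : List α) {l : List ℕ} (hl : l.Nodup) :
    {v | ∃ p ∈ l, v ∈ squaresAt w p}.ncard = (l.map fun p => (squaresAt w p).ncard).sum := by
  suffices h : {v | ∃ p ∈ l, v ∈ squaresAt w p}.Finite ∧
      {v | ∃ p ∈ l, v ∈ squaresAt w p}.ncard = (l.map fun p => (squaresAt w p).ncard).sum from h.2
  induction l with
  | nil => simp
  | cons q l ih =>
    obtain ⟨hq, hl⟩ := List.nodup_cons.1 hl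
    obtain ⟨hfin, hcard⟩ := ih hl
    have hset : {v | ∃ p ∈ q :: l, v ∈ squaresAt w p} =
        squaresAt w q ∪ {v | ∃ p ∈ l, v ∈ squaresAt w p} := by
      ext v; simp
    rw [hset]
    refine ⟨(squaresAt_finite w q).union hfin, ?_⟩
    rw [Set.ncard_union_eq _ (squaresAt_finite w q) hfin, hcard, List.map_cons, List.sum_cons]
    rw [Set.disjoint_left]
    rintro v hv ⟨p, hp, hv'⟩
    exact Set.disjoint_left.1 (squaresAt_disjoint w fun h : q = p => hq (h ▸ hp)) hv hv'

theorem drop_take_distinctSquareSeq (w : List α) {m n : ℕ} (h : m + n ≤ w.length) :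
    ((distinctSquareSeq w).drop m).take n =
      (List.range' (m + 1) n).map fun p => (squaresAt w p).ncard := by
  apply List.ext_getElem
  · simp [distinctSquareSeq]; omega
  · intro x h1 h2
    simp [distinctSquareSeq]
    congr 2; omega

theorem ncard_squares_of_option (o : Option (List α)) :
    {v : List α | ∃ u ∈ o, v = u ++ u}.ncard = if o.isSome then 1 else 0 := by
  cases o <;> simp

theorem isSome_tableRoot (a b : α) (k p : ℕ) :
    (tableRoot a b k p).isSome ↔ p ≤ 2 * k + 1 ∨ (3 * k + 2 < p ∧ p ≤ 4 * k + 2) ∨ 4 * k + 3 < p := by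
  unfold tableRoot
  split_ifs <;> simp <;> omega

theorem length_blockSeq {k : ℕ} : (blockSeq k).length = 6 * k + 3 := by
  simp [blockSeq]; omega

theorem sum_blockSeq (k : ℕ) : (blockSeq k).sum = 5 * k + 1 := by
  simp [blockSeq]; omega

theorem getElem_blockSeq {k x : ℕ} (h : x < (blockSeq k).length) :
    (blockSeq k)[x] =
      if x ≤ 2 * k ∨ (3 * k + 2 ≤ x ∧ x < 4 * k + 2) ∨ 4 * k + 3 ≤ x then 1 else 0 := by
  simp only [blockSeq, List.getElem_append, List.getElem_replicate, List.length_append,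
    List.length_replicate, List.length_singleton, List.getElem_singleton]
  split_ifs <;> omega

end counting

theorem mainTheorem6 {α : Type*} (a b : α) (hab : a ≠ b) (i j k : ℕ)
    (hi : 1 ≤ i) (hik : i ≤ k) (hkj : k < j) :
    -- the block `X_k` of `Y_{i,j}` occupies the positions `L + 1, …, L + (6k+3)`,
    -- where `L` is the length of `X_i ⋯ X_{k-1}`
    wordY a b i j = blocksX a b i k ++ wordX a b k ++
        (blocksX a b (k + 1) (j + 1) ++ ([a] ++ letterPow a (j - 1))) ∧
    (wordX a b k).length = 6 * k + 3 ∧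
    -- the part of the distinct-square-sequence of `Y_{i,j}` at these positions
    ((distinctSquareSeq (wordY a b i j)).drop (blocksX a b i k).length).take (6 * k + 3) =
      blockSeq k ∧
    -- the number of distinct squares whose last occurrence begins in `X_k`
    {v : List α | ∃ p : ℕ, 1 ≤ p ∧ p ≤ 6 * k + 3 ∧
        v ∈ squaresAt (wordY a b i j) ((blocksX a b i k).length + p)}.ncard = 5 * k + 1 ∧
    -- these squares are the ones in the table, and no others
    ∀ p : ℕ, 1 ≤ p → p ≤ 6 * k + 3 →
      squaresAt (wordY a b i j) ((blocksX a b i k).length + p) =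
        {v : List α | ∃ u ∈ tableRoot a b k p, v = u ++ u} := by
  have hY : wordY a b i j = blocksX a b i k ++ wordX a b k ++
      (blocksX a b (k + 1) (j + 1) ++ ([a] ++ letterPow a (j - 1))) := by
    rw [wordY, ← blocksX_append a b hik (show k ≤ j + 1 by omega),
      ← blocksX_append a b (show k ≤ k + 1 by omega) (show k + 1 ≤ j + 1 by omega), blocksX_succ]
    simp only [List.append_assoc]
  have hX := length_wordX a b (hi.trans hik)
  have htab := fun p => squaresAt_wordY hab hi hik hkj (p := p)
  set L := (blocksX a b i k).length with hL
  have hlen : L + (6 * k + 3) ≤ (wordY a b i j).length := by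
    rw [hY, List.length_append, List.length_append, hX]; omega
  have hmap : (List.range' (L + 1) (6 * k + 3)).map
      (fun p => (squaresAt (wordY a b i j) p).ncard) = blockSeq k := by
    apply List.ext_getElem
    · rw [length_blockSeq]; simp
    · intro x h1 h2
      rw [length_blockSeq] at h2
      rw [getElem_blockSeq, List.getElem_map, List.getElem_range', one_mul, add_assoc,
        htab (1 + x) (by omega) (by omega), ncard_squares_of_option]
      simp only [isSome_tableRoot]
      exact if_congr (by omega) rfl rfl
  refine ⟨hY, hX, (drop_take_distinctSquareSeq _ hlen).trans hmap, ?_, htab⟩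
  rw [← sum_blockSeq k, ← hmap, ← ncard_exists_mem_squaresAt _ List.nodup_range']
  congr 1
  ext v
  simp only [Set.mem_ofPred_eq, List.mem_range'_1]
  constructor
  · rintro ⟨p, h1, h2, hv⟩
    exact ⟨L + p, by omega, hv⟩
  · rintro ⟨p, h, hv⟩
    exact ⟨p - L, by omega, by omega, by rwa [Nat.add_sub_cancel' (by omega)]⟩
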